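/- Let $R>1$, let $J(\omega)=\frac12(\omega+\omega^{-1})$ be the Joukowski map, and let $E_R\subset\mathbb{C}$ be the open Bernstein ellipse with foci $\pm1$ whose semi-axes $\frac12(R\pm R^{-1})$ have sum $R$. Let $H^\infty(E_R)$ be the space of bounded analytic functions on $E_R$ with the supremum norm. Let $z\in E_R\setminus[-1,1]$ and put $$J^{-1}(z)=z+(z-1)\sqrt{\frac{z+1}{z-1}}\quad(\text{principal square root}),\qquad \alpha(z)=1-\frac{\ln|J^{-1}(z)|}{\ln R}.$$ Then $J(J^{-1}(z))=z$, $1<|J^{-1}(z)|<R$ and $\alpha(z)\in(0,1)$, and the following hold, where $c$ and $C$ denote positive constants that depend only on $R$ and $z$. (a) There is $C>0$ such that for every $\varepsilon>0$ and every $F\in H^\infty(E_R)$ with $\|F\|_{H^\infty(E_R)}\le1$ and $\|F\|_{L^\infty(-1,1)}\le\varepsilon$, $$|F(z)|\le C\,\varepsilon^{\alpha(z)}.$$ (b) The bound in (a) is asymptotically optimal as $\varepsilon\to0$: there is $c>0$ such that for every $0<\varepsilon\le1$ some $F\in H^\infty(E_R)$ with $\|F\|_{H^\infty(E_R)}\le1$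 and $\|F\|_{L^\infty(-1,1)}\le\varepsilon$ satisfies $|F(z)|\ge c\,\varepsilon^{\alpha(z)}$. (c) The bound is attained, up to constants, by $$M_\varepsilon(\zeta)=\varepsilon^{2-\alpha(z)}\sum_{n=1}^{\infty}\frac{\bigl(\overline{J^{-1}(z)}\bigr)^{n}\,T_n(\zeta)}{1+\varepsilon^{2}R^{2n}},$$ where $T_n$ is the Chebyshev polynomial of degree $n$, $T_n(\cos\theta)=\cos n\theta$. That is, there are $c,C>0$ such that for every $\varepsilon>0$ the series converges absolutely at every $\zeta\in E_R$, $M_\varepsilon\in H^\infty(E_R)$, $\|M_\varepsilon\|_{H^\infty(E_R)}\le C$, $\|M_\varepsilon\|_{L^\infty(-1,1)}\le C\varepsilon$ and $|M_\varepsilon(z)|\le C\varepsilon^{\alpha(z)}$; and $|M_\varepsilon(z)|\ge c\,\varepsilon^{\alpha(z)}$ whenever $0<\varepsilon\le1$. -/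

import Mathlib

open MeasureTheory
open scoped ENNReal ComplexConjugate

noncomputable section

/-- The Joukowski map `J(ω) = (ω + ω⁻¹) / 2`. -/
def joukowski (ω : ℂ) : ℂ := (ω + ω⁻¹) / 2

/-- The branch of the inverse of the Joukowski map with values outside the closed unit disk:
`J⁻¹(z) = z + (z - 1) √((z + 1) / (z - 1))`, with the principal square root
(meaningful for `z ∉ [-1, 1]`). -/
def joukowskiInv (z : ℂ) : ℂ := z + (z - 1) * ((z + 1) / (z - 1)) ^ (1 / 2 : ℂ)

/-- The closed interval `[-1, 1]` of the real axis, as a subset of `ℂ`. -/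
def realSegment : Set ℂ := (fun x : ℝ => (x : ℂ)) '' Set.Icc (-1) 1

/-- The open ellipse with foci `± 1` and sum of semi-axes `R`: its semi-major axis
is `(R + R⁻¹) / 2`, so the sum of the distances to the foci is less than `R + R⁻¹`. -/
def bernsteinEllipse (R : ℝ) : Set ℂ := {z : ℂ | dist z 1 + dist z (-1) < R + R⁻¹}

/-- The supremum norm over `U`, with value `∞` for unbounded functions. -/
def hInfNorm (U : Set ℂ) (F : ℂ → ℂ) : ℝ≥0∞ := ⨆ ζ ∈ U, ‖F ζ‖ₑ

/-- Membership in `H^∞(U)`, for `U` open: bounded analytic functions on `U`. -/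
def MemHInf (U : Set ℂ) (F : ℂ → ℂ) : Prop := DifferentiableOn ℂ F U ∧ hInfNorm U F < ∞

/-- The norm of `F` in `L^∞(-1, 1)` (essential supremum for the Lebesgue measure). -/
def lInfNormInterval (F : ℂ → ℂ) : ℝ≥0∞ :=
  eLpNorm (fun x : ℝ => F (x : ℂ)) ∞ (volume.restrict (Set.Ioo (-1 : ℝ) 1))

/-- The exponent `α(z) = 1 - ln |J⁻¹(z)| / ln R`. -/
def ellipseExponent (R : ℝ) (z : ℂ) : ℝ := 1 - Real.log ‖joukowskiInv z‖ / Real.log R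

/-- The `n`-th term of the Chebyshev series defining the extremal function. -/
def extremalTerm (R : ℝ) (z : ℂ) (ε : ℝ) (n : ℕ) (ζ : ℂ) : ℂ :=
  (conj (joukowskiInv z)) ^ n * (Polynomial.Chebyshev.T ℂ (n : ℤ)).eval ζ /
    (1 + (ε : ℂ) ^ 2 * (R : ℂ) ^ (2 * n))

/-- `M(ζ) = ε ^ (2 - α(z)) ∑_{n ≥ 1} conj(J⁻¹(z))ⁿ Tₙ(ζ) / (1 + ε² R²ⁿ)`. -/
def extremalFun (R : ℝ) (z : ℂ) (ε : ℝ) (ζ : ℂ) : ℂ :=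
  ((ε ^ (2 - ellipseExponent R z) : ℝ) : ℂ) * ∑' n : ℕ, extremalTerm R z ε (n + 1) ζ

end

/-! The Joukowski map carries the annulus `1 < |ω| < R` onto the ellipse minus `[-1, 1]` and the
unit circle onto `[-1, 1]`. For (a), `s ↦ F (J (exp s))` is analytic on the strip `0 ≤ Re s < log
R`, at most `ε` on the left edge and at most 1 elsewhere, so the three lines theorem gives `ε ^ α`
(`norm_le_rpow_ellipseExponent`). For (c), put `w = J⁻¹(z)`, so that `|w| = R ^ (1 - α)`. Each bound
on `M` reduces to `∑ R ^ (s n) / (1 + ε² R ^ (2n)) ≤ K ε ^ (-s)` with `0 < s < 2`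
(`exists_tsum_pow_div_le`). The terms at `z` have nonnegative real part, so the single term with `R
^ n ≈ ε⁻¹` gives the lower bound (`le_norm_extremalFun`). Dividing `M` by its constant proves (b).
-/

/-! ### Geometry of the Joukowski map. -/

theorem dist_joukowski_add_dist {ω : ℂ} (hω : ω ≠ 0) :
    dist (joukowski ω) 1 + dist (joukowski ω) (-1) = ‖ω‖ + ‖ω‖⁻¹ := by
  have h1 : joukowski ω - 1 = (ω - 1) ^ 2 / (2 * ω) := by
    unfold joukowski; field_simp; ring
  have h2 : joukowski ω - (-1) = (ω + 1) ^ 2 / (2 * ω) := by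
    unfold joukowski; field_simp; ring
  have hpos : 0 < ‖ω‖ := norm_pos_iff.mpr hω
  have h3 := parallelogram_law_with_norm ℝ ω 1
  rw [dist_eq_norm, dist_eq_norm, h1, h2]
  simp only [norm_div, norm_pow, norm_mul, Complex.norm_two, norm_one] at h3 ⊢
  field_simp
  linarith

theorem joukowski_mem_bernsteinEllipse_iff {R : ℝ} (hR : 1 < R) {ω : ℂ} (hω : 1 ≤ ‖ω‖) :
    joukowski ω ∈ bernsteinEllipse R ↔ ‖ω‖ < R := by
  have hpos : 0 < ‖ω‖ := by linarith
  have h0 : ω ≠ 0 := norm_pos_iff.mp hpos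
  have hR0 : 0 < R := by linarith
  unfold bernsteinEllipse
  rw [Set.mem_ofPred_eq, dist_joukowski_add_dist h0]
  have key : R + R⁻¹ - (‖ω‖ + ‖ω‖⁻¹) = (R - ‖ω‖) * ((R * ‖ω‖ - 1) / (R * ‖ω‖)) := by
    field_simp; ring
  have h1 : 0 < (R * ‖ω‖ - 1) / (R * ‖ω‖) := by
    apply div_pos _ (by positivity)
    nlinarith
  rw [← sub_pos, key, mul_pos_iff_of_pos_right h1, sub_pos]

theorem exists_joukowski_eq (ζ : ℂ) : ∃ ω : ℂ, 1 ≤ ‖ω‖ ∧ joukowski ω = ζ := by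
  obtain ⟨s, hs⟩ := IsAlgClosed.exists_pow_nat_eq (ζ ^ 2 - 1) (n := 2) (by norm_num)
  -- The two preimages of `ζ` are mutually inverse, so one of them has norm at least 1.
  have hprod : (ζ + s) * (ζ - s) = 1 := by linear_combination -hs
  have h1 : ζ + s ≠ 0 := left_ne_zero_of_mul_eq_one hprod
  have h2 : ζ - s ≠ 0 := right_ne_zero_of_mul_eq_one hprod
  have hn : ‖ζ + s‖ * ‖ζ - s‖ = 1 := by rw [← norm_mul, hprod, norm_one]
  rcases le_total 1 ‖ζ + s‖ with h | h
  · refine ⟨ζ + s, h, ?_⟩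
    rw [joukowski, inv_eq_of_mul_eq_one_right hprod]; ring
  · refine ⟨ζ - s, ?_, ?_⟩
    · have := norm_nonneg (ζ - s)
      nlinarith
    · rw [joukowski, inv_eq_of_mul_eq_one_left hprod]; ring

theorem exists_joukowski_eq_of_mem_bernsteinEllipse {R : ℝ} (hR : 1 < R) {ζ : ℂ}
    (hζ : ζ ∈ bernsteinEllipse R) : ∃ ω : ℂ, 1 ≤ ‖ω‖ ∧ ‖ω‖ < R ∧ joukowski ω = ζ := by
  obtain ⟨ω, h1, rfl⟩ := exists_joukowski_eq ζ
  exact ⟨ω, h1, (joukowski_mem_bernsteinEllipse_iff hR h1).mp hζ, rfl⟩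

theorem joukowski_eq_re_of_norm_eq_one {ω : ℂ} (hω : ‖ω‖ = 1) : joukowski ω = (ω.re : ℂ) := by
  rw [joukowski, Complex.inv_eq_conj hω, Complex.add_conj]
  push_cast; ring

theorem exists_joukowski_eq_ofReal {x : ℝ} (hx : x ∈ Set.Icc (-1 : ℝ) 1) :
    ∃ ω : ℂ, ‖ω‖ = 1 ∧ joukowski ω = (x : ℂ) := by
  have hn : ‖Complex.exp (Real.arccos x * Complex.I)‖ = 1 := Complex.norm_exp_ofReal_mul_I _
  refine ⟨_, hn, ?_⟩
  rw [joukowski_eq_re_of_norm_eq_one hn, Complex.exp_ofReal_mul_I_re,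
    Real.cos_arccos hx.1 hx.2]

theorem ofReal_mem_bernsteinEllipse {R : ℝ} (hR : 1 < R) {x : ℝ} (hx : x ∈ Set.Icc (-1 : ℝ) 1) :
    (x : ℂ) ∈ bernsteinEllipse R := by
  obtain ⟨ω, h1, h2⟩ := exists_joukowski_eq_ofReal hx
  rw [← h2, joukowski_mem_bernsteinEllipse_iff hR h1.ge, h1]
  exact hR

theorem isOpen_bernsteinEllipse (R : ℝ) : IsOpen (bernsteinEllipse R) :=
  isOpen_lt (by fun_prop) continuous_const

theorem mem_realSegment_of_div_mem {z : ℂ} (hz : z ≠ 1)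
    (h : (z + 1) / (z - 1) ∉ Complex.slitPlane) : z ∈ realSegment := by
  have hz1 : z - 1 ≠ 0 := sub_ne_zero.mpr hz
  set q := (z + 1) / (z - 1) with hq
  rw [Complex.mem_slitPlane_iff, not_or, not_lt, not_not] at h
  obtain ⟨hre, him⟩ := h
  have hqr : q = (q.re : ℂ) := Complex.ext rfl (by simp [him])
  set t := q.re with ht
  have hmul : (t : ℂ) * (z - 1) = z + 1 := by rw [← hqr, hq]; field_simp
  have ht1 : t - 1 < 0 := by linarith
  refine ⟨(t + 1) / (t - 1), ⟨?_, ?_⟩, ?_⟩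
  · rw [le_div_iff_of_neg ht1]; linarith
  · rw [div_le_iff_of_neg ht1]; linarith
  · have h2 : (t : ℂ) - 1 ≠ 0 := by exact_mod_cast ht1.ne
    push_cast
    rw [div_eq_iff h2]
    linear_combination -hmul

/-- With `s` the principal root, `J⁻¹(z) = (s + 1) / (s - 1)`. Off the segment the radicand avoids
the branch cut, so `Re s > 0` and `s` is closer to 1 than to -1. -/
theorem joukowskiInv_spec {z : ℂ} (hz : z ∉ realSegment) :
    joukowski (joukowskiInv z) = z ∧ 1 < ‖joukowskiInv z‖ := by
  have hz1 : z ≠ 1 := by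
    rintro rfl
    exact hz ⟨1, by norm_num, by simp⟩
  have hzs : z - 1 ≠ 0 := sub_ne_zero.mpr hz1
  have hslit : (z + 1) / (z - 1) ∈ Complex.slitPlane :=
    not_not.mp fun h => hz (mem_realSegment_of_div_mem hz1 h)
  set s := ((z + 1) / (z - 1)) ^ (1 / 2 : ℂ) with hs
  have hs2 : s ^ 2 = (z + 1) / (z - 1) := by
    have := Complex.cpow_nat_inv_pow ((z + 1) / (z - 1)) (n := 2) (by norm_num)
    rw [hs, one_div]; exact_mod_cast this
  have hre : 0 < s.re := by
    rw [hs, Complex.cpow_def_of_ne_zero (Complex.slitPlane_ne_zero hslit), Complex.exp_re]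
    apply mul_pos (Real.exp_pos _)
    have him : (Complex.log ((z + 1) / (z - 1)) * (1 / 2)).im
        = Complex.arg ((z + 1) / (z - 1)) / 2 := by
      rw [show (1 / 2 : ℂ) = ((1 / 2 : ℝ) : ℂ) by push_cast; rfl, Complex.im_mul_ofReal,
        Complex.log_im]; ring
    rw [him]
    apply Real.cos_pos_of_mem_Ioo
    have h1 := Complex.neg_pi_lt_arg ((z + 1) / (z - 1))
    have h2 := lt_of_le_of_ne (Complex.arg_le_pi ((z + 1) / (z - 1)))
      (Complex.mem_slitPlane_iff_arg.mp hslit).1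
    constructor <;> linarith
  have hmul : s ^ 2 * (z - 1) = z + 1 := by rw [hs2]; field_simp
  have hw : joukowskiInv z = z + (z - 1) * s := rfl
  have hz2 : (s ^ 2 - 1) * (z - 1) = 2 := by linear_combination hmul
  have hprod : (s - 1) * (s + 1) ≠ 0 := by
    intro h
    have h0 : s ^ 2 - 1 = 0 := by linear_combination h
    rw [h0, zero_mul] at hz2
    exact two_ne_zero hz2.symm
  have hm : s - 1 ≠ 0 := left_ne_zero_of_mul hprod
  have hp : s + 1 ≠ 0 := right_ne_zero_of_mul hprod
  have hw2 : joukowskiInv z = (s + 1) / (s - 1) := by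
    rw [hw, eq_div_iff hm]; linear_combination hmul
  constructor
  · rw [hw2, joukowski, inv_div]
    field_simp
    linear_combination -2*hz2
  · rw [hw2, norm_div, one_lt_div (norm_pos_iff.mpr hm)]
    apply lt_of_pow_lt_pow_left₀ 2 (norm_nonneg _)
    rw [Complex.sq_norm, Complex.sq_norm, Complex.normSq_apply, Complex.normSq_apply]
    simp
    nlinarith

/-! ### Chebyshev polynomials and the basic series estimate. -/

theorem chebyshev_T_eval_joukowski {ω : ℂ} (hω : ω ≠ 0) (n : ℕ) :
    (Polynomial.Chebyshev.T ℂ (n : ℤ)).eval (joukowski ω) = (ω ^ n + (ω⁻¹) ^ n) / 2 := by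
  obtain ⟨x, rfl⟩ : ∃ x, Complex.exp x = ω := ⟨_, Complex.exp_log hω⟩
  have : joukowski (Complex.exp x) = Complex.cosh x := by
    rw [joukowski, Complex.cosh, Complex.exp_neg]
  rw [this, Polynomial.Chebyshev.T_complex_cosh, Complex.cosh, ← Complex.exp_neg,
    ← Complex.exp_nat_mul, ← Complex.exp_nat_mul]
  simp

theorem norm_chebyshev_T_eval_joukowski_le {ω : ℂ} (hω : 1 ≤ ‖ω‖) (n : ℕ) :
    ‖(Polynomial.Chebyshev.T ℂ (n : ℤ)).eval (joukowski ω)‖ ≤ ‖ω‖ ^ n := by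
  have h0 : ω ≠ 0 := norm_pos_iff.mp (by linarith)
  rw [chebyshev_T_eval_joukowski h0, norm_div, Complex.norm_two]
  have h1 : ‖ω ^ n + (ω⁻¹) ^ n‖ ≤ ‖ω‖ ^ n + (‖ω‖⁻¹) ^ n :=
    (norm_add_le _ _).trans_eq (by simp)
  have h2 : (‖ω‖⁻¹) ^ n ≤ ‖ω‖ ^ n :=
    pow_le_pow_left₀ (by positivity) ((inv_le_one_of_one_le₀ hω).trans hω) n
  linarith

theorem summable_min_zpow {a b : ℝ} (ha : 1 < a) (hb : 1 < b) :
    Summable fun k : ℤ => min (a ^ k) (b ^ (1 - k)) := by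
  have ha0 : 0 < a := by linarith
  have hb0 : 0 < b := by linarith
  apply Summable.of_nat_of_neg
  · refine Summable.of_nonneg_of_le (fun n => by positivity) (fun n => min_le_right _ _) ?_
    have h : ∀ n : ℕ, b ^ (1 - (n : ℤ)) = b * (b⁻¹) ^ n := fun n => by
      rw [zpow_sub₀ hb0.ne', zpow_one, zpow_natCast, inv_pow, div_eq_mul_inv]
    simp_rw [h]
    exact (summable_geometric_of_lt_one (by positivity) (inv_lt_one_of_one_lt₀ hb)).mul_left b
  · refine Summable.of_nonneg_of_le (fun n => by positivity) (fun n => min_le_left _ _) ?_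
    have h : ∀ n : ℕ, a ^ (-(n : ℤ)) = (a⁻¹) ^ n := fun n => by
      rw [zpow_neg, zpow_natCast, inv_pow]
    simp_rw [h]
    exact summable_geometric_of_lt_one (by positivity) (inv_lt_one_of_one_lt₀ ha)

/-- The terms grow like `R ^ (s n)` until `R ^ n ≈ ε⁻¹`, then decay like `ε⁻² R ^ (-(2 - s) n)`.
Recentred at the peak and divided by `ε ^ (-s)`, they lie below a two-sided geometric sequence
independent of `ε`. -/
theorem exists_tsum_pow_div_le {R s : ℝ} (hR : 1 < R) (hs0 : 0 < s) (hs2 : s < 2) :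
    ∃ K : ℝ, 0 < K ∧ ∀ ε : ℝ, 0 < ε →
      (Summable fun n : ℕ => (R ^ s) ^ (n + 1) / (1 + ε ^ 2 * R ^ (2 * (n + 1)))) ∧
      ∑' n : ℕ, (R ^ s) ^ (n + 1) / (1 + ε ^ 2 * R ^ (2 * (n + 1))) ≤ K * ε ^ (-s) := by
  have hR0 : 0 < R := by linarith
  set a := R ^ s with ha
  set b := R ^ (2 - s) with hb
  have ha1 : 1 < a := Real.one_lt_rpow hR hs0
  have hb1 : 1 < b := Real.one_lt_rpow hR (by linarith)
  have ha0 : 0 < a := by linarith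
  have hb0 : 0 < b := by linarith
  have hab : a * b = R ^ 2 := by
    rw [ha, hb, ← Real.rpow_add hR0, ← Real.rpow_natCast]; norm_num
  have hsum := summable_min_zpow ha1 hb1
  have hnn : ∀ k : ℤ, 0 ≤ min (a ^ k) (b ^ (1 - k)) := fun k => by positivity
  refine ⟨∑' k : ℤ, min (a ^ k) (b ^ (1 - k)),
    hsum.tsum_pos hnn 0 (by positivity), fun ε hε => ?_⟩
  -- The peak: `R ^ m ≤ ε⁻¹ < R ^ (m + 1)`, with `m` negative when `ε > 1`.
  obtain ⟨m, hm1, hm2⟩ := exists_mem_Ico_zpow (inv_pos.mpr hε) hR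
  have hεs : ε ^ (-s) = (ε⁻¹) ^ s := by rw [Real.rpow_neg hε.le, Real.inv_rpow hε.le]
  have ham : a ^ m ≤ ε ^ (-s) := by
    rw [hεs, ha, ← Real.rpow_intCast, ← Real.rpow_mul hR0.le, mul_comm, Real.rpow_mul hR0.le,
      Real.rpow_intCast]
    exact Real.rpow_le_rpow (by positivity) hm1 hs0.le
  have hbm : ε⁻¹ ^ 2 ≤ ε ^ (-s) * b ^ (m + 1) := by
    have h1 : (ε⁻¹) ^ (2 - s) ≤ b ^ (m + 1) := by
      rw [hb, ← Real.rpow_intCast, ← Real.rpow_mul hR0.le, mul_comm, Real.rpow_mul hR0.le,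
        Real.rpow_intCast]
      exact Real.rpow_le_rpow (by positivity) hm2.le (by linarith)
    calc ε⁻¹ ^ 2 = (ε⁻¹) ^ s * (ε⁻¹) ^ (2 - s) := by
          rw [← Real.rpow_add (inv_pos.mpr hε), ← Real.rpow_natCast]; norm_num
      _ ≤ _ := by rw [hεs]; gcongr
  have hterm : ∀ n : ℕ, a ^ (n + 1) / (1 + ε ^ 2 * R ^ (2 * (n + 1))) ≤
      ε ^ (-s) * min (a ^ ((n : ℤ) + 1 - m)) (b ^ (1 - ((n : ℤ) + 1 - m))) := by
    intro n
    rw [mul_min_of_nonneg _ _ (by positivity)]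
    apply le_min
    · calc a ^ (n + 1) / (1 + ε ^ 2 * R ^ (2 * (n + 1))) ≤ a ^ (n + 1) :=
            div_le_self (by positivity) (le_add_of_nonneg_right (by positivity))
        _ = a ^ m * a ^ ((n : ℤ) + 1 - m) := by
            rw [← zpow_add₀ ha0.ne', ← zpow_natCast]; congr 1; push_cast; ring
        _ ≤ _ := by gcongr
    · calc a ^ (n + 1) / (1 + ε ^ 2 * R ^ (2 * (n + 1)))
          ≤ a ^ (n + 1) / (ε ^ 2 * R ^ (2 * (n + 1))) := by
            gcongr; linarith
        _ = ε⁻¹ ^ 2 * (b ^ (n + 1))⁻¹ := by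
            rw [pow_mul, ← hab, mul_pow]; field_simp
        _ ≤ ε ^ (-s) * b ^ (m + 1) * (b ^ (n + 1))⁻¹ := by gcongr
        _ = _ := by
            rw [mul_assoc, ← zpow_natCast, ← zpow_neg, ← zpow_add₀ hb0.ne']
            congr 2; push_cast; ring
  have hinj : Function.Injective fun n : ℕ => (n : ℤ) + 1 - m := fun i j h => by
    simp only at h; omega
  have hsub := hsum.comp_injective hinj
  have hS : Summable fun n : ℕ => a ^ (n + 1) / (1 + ε ^ 2 * R ^ (2 * (n + 1))) :=
    Summable.of_nonneg_of_le (fun n => by positivity) hterm (hsub.mul_left _)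
  refine ⟨hS, (hS.tsum_le_tsum hterm (hsub.mul_left _)).trans ?_⟩
  rw [tsum_mul_left, mul_comm]
  gcongr
  exact tsum_comp_le_tsum_of_inj hsum hnn hinj

/-! ### From norms to pointwise bounds and back. -/

theorem norm_le_of_lInfNormInterval_le {F : ℂ → ℂ} {ε : ℝ} (hε : 0 ≤ ε)
    (hF : ContinuousOn (fun x : ℝ => F x) (Set.Icc (-1) 1))
    (h : lInfNormInterval F ≤ ENNReal.ofReal ε) {x : ℝ} (hx : x ∈ Set.Icc (-1 : ℝ) 1) :
    ‖F x‖ ≤ ε := by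
  have h1 : ∀ᵐ y : ℝ ∂(volume.restrict (Set.Icc (-1 : ℝ) 1)), ‖F y‖ ≤ ε := by
    rw [← Measure.restrict_congr_set Ioo_ae_eq_Icc]
    unfold lInfNormInterval at h
    rw [eLpNorm_exponent_top] at h
    filter_upwards [enorm_ae_le_eLpNormEssSup (fun x : ℝ => F (x : ℂ))
      (volume.restrict (Set.Ioo (-1 : ℝ) 1))] with y hy
    have := hy.trans h
    rwa [← ofReal_norm, ENNReal.ofReal_le_ofReal_iff hε] at this
  -- Writing the inequality as the equality `max ‖F y‖ ε = ε` lets continuity upgrade it from almost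
  -- everywhere to everywhere.
  have h2 : (fun y : ℝ => max ‖F y‖ ε) =ᵐ[volume.restrict (Set.Icc (-1 : ℝ) 1)] fun _ => ε :=
    h1.mono fun y hy => max_eq_right hy
  have h3 := Measure.eqOn_Icc_of_ae_eq volume (by norm_num : (-1 : ℝ) ≠ 1) h2
    (hF.norm.sup continuousOn_const) continuousOn_const hx
  exact max_eq_right_iff.mp h3

theorem lInfNormInterval_le_ofReal {F : ℂ → ℂ} {ε : ℝ}
    (h : ∀ x ∈ Set.Icc (-1 : ℝ) 1, ‖F (x : ℂ)‖ ≤ ε) :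
    lInfNormInterval F ≤ ENNReal.ofReal ε := by
  unfold lInfNormInterval
  rw [eLpNorm_exponent_top]
  apply eLpNormEssSup_le_of_ae_enorm_bound
  filter_upwards [ae_restrict_mem measurableSet_Ioo] with x hx
  rw [← ofReal_norm]
  exact ENNReal.ofReal_le_ofReal (h x (Set.Ioo_subset_Icc_self hx))

theorem hInfNorm_le_ofReal {U : Set ℂ} {F : ℂ → ℂ} {C : ℝ} (h : ∀ ζ ∈ U, ‖F ζ‖ ≤ C) :
    hInfNorm U F ≤ ENNReal.ofReal C :=
  iSup₂_le fun ζ hζ => by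
    rw [← ofReal_norm]
    exact ENNReal.ofReal_le_ofReal (h ζ hζ)

theorem norm_le_of_hInfNorm_le {U : Set ℂ} {F : ℂ → ℂ} {C : ℝ} (hC : 0 ≤ C)
    (h : hInfNorm U F ≤ ENNReal.ofReal C) {ζ : ℂ} (hζ : ζ ∈ U) : ‖F ζ‖ ≤ C := by
  rw [← ENNReal.ofReal_le_ofReal_iff hC, ofReal_norm]
  exact (le_iSup₂ (f := fun ζ (_ : ζ ∈ U) => ‖F ζ‖ₑ) ζ hζ).trans h

/-! ### The upper bound by the three lines theorem. -/

/-- `F` is controlled only on the open ellipse, so the right edge is placed at `log r` with `r < R`;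
the limit `r → R` is taken afterwards. -/
theorem norm_le_rpow_of_norm_lt {R r ε : ℝ} {F : ℂ → ℂ} (hr1 : 1 < r) (hrR : r < R)
    (hF : DifferentiableOn ℂ F (bernsteinEllipse R))
    (hF1 : ∀ ζ ∈ bernsteinEllipse R, ‖F ζ‖ ≤ 1)
    (hFε : ∀ x ∈ Set.Icc (-1 : ℝ) 1, ‖F (x : ℂ)‖ ≤ ε) {ω : ℂ} (h1 : 1 ≤ ‖ω‖) (h2 : ‖ω‖ ≤ r) :
    ‖F (joukowski ω)‖ ≤ ε ^ (1 - Real.log ‖ω‖ / Real.log r) := by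
  have hω : ω ≠ 0 := norm_pos_iff.mp (by linarith)
  have hlog : 0 < Real.log r := Real.log_pos hr1
  have hmem : ∀ s : ℂ, 0 ≤ s.re → s.re ≤ Real.log r →
      joukowski (Complex.exp s) ∈ bernsteinEllipse R := by
    intro s hs0 hs1
    rw [joukowski_mem_bernsteinEllipse_iff (hr1.trans hrR)
      (by rw [Complex.norm_exp]; exact Real.one_le_exp hs0), Complex.norm_exp]
    exact lt_of_le_of_lt (by rwa [← Real.le_log_iff_exp_le (by linarith)]) hrR
  have hJ : Differentiable ℂ fun s : ℂ => joukowski (Complex.exp s) := by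
    unfold joukowski
    intro s
    have : Complex.exp s ≠ 0 := Complex.exp_ne_zero s
    fun_prop (disch := assumption)
  have hmaps : Set.MapsTo (fun s : ℂ => joukowski (Complex.exp s))
      (Complex.HadamardThreeLines.verticalClosedStrip 0 (Real.log r)) (bernsteinEllipse R) :=
    fun s hs => hmem s hs.1 hs.2
  have hdiff : DifferentiableOn ℂ (fun s : ℂ => F (joukowski (Complex.exp s)))
      (Complex.HadamardThreeLines.verticalClosedStrip 0 (Real.log r)) :=
    hF.comp hJ.differentiableOn hmaps
  have hd : DiffContOnCl ℂ (fun s : ℂ => F (joukowski (Complex.exp s)))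
      (Complex.HadamardThreeLines.verticalStrip 0 (Real.log r)) := by
    apply DifferentiableOn.diffContOnCl
    rwa [Complex.HadamardThreeLines.verticalStrip, Complex.closure_preimage_re,
      closure_Ioo hlog.ne]
  have key := Complex.HadamardThreeLines.norm_le_interp_of_mem_verticalClosedStrip'
    (z := Complex.log ω) (a := ε) (b := 1) hlog
    (by
      constructor
      · rw [Complex.log_re]; exact Real.log_nonneg h1
      · rw [Complex.log_re]; exact Real.log_le_log (by linarith) h2) hd
    (by
      refine ⟨1, ?_⟩
      rintro _ ⟨s, hs, rfl⟩
      exact hF1 _ (hmaps hs))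
    (by
      intro s hs
      have hn : ‖Complex.exp s‖ = 1 := by
        rw [Complex.norm_exp, show s.re = 0 from hs, Real.exp_zero]
      rw [joukowski_eq_re_of_norm_eq_one hn]
      refine hFε _ (abs_le.mp ((Complex.abs_re_le_norm _).trans hn.le)))
    (by
      intro s hs
      have hs' : s.re = Real.log r := hs
      exact hF1 _ (hmem s (by linarith) hs'.le))
  simpa [Complex.exp_log hω, Complex.log_re] using key

theorem norm_le_rpow_ellipseExponent {R ε : ℝ} {F : ℂ → ℂ} (hR : 1 < R) (hε : 0 < ε)
    (hF : DifferentiableOn ℂ F (bernsteinEllipse R))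
    (hF1 : ∀ ζ ∈ bernsteinEllipse R, ‖F ζ‖ ≤ 1)
    (hFε : ∀ x ∈ Set.Icc (-1 : ℝ) 1, ‖F (x : ℂ)‖ ≤ ε) {ω : ℂ} (h1 : 1 ≤ ‖ω‖) (h2 : ‖ω‖ < R) :
    ‖F (joukowski ω)‖ ≤ ε ^ (1 - Real.log ‖ω‖ / Real.log R) := by
  have hlog : Real.log R ≠ 0 := (Real.log_pos hR).ne'
  have hR0 : R ≠ 0 := by linarith
  have ht : Filter.Tendsto (fun r : ℝ => ε ^ (1 - Real.log ‖ω‖ / Real.log r))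
      (nhdsWithin R (Set.Iio R)) (nhds (ε ^ (1 - Real.log ‖ω‖ / Real.log R))) := by
    apply ContinuousAt.continuousWithinAt
    apply ContinuousAt.rpow continuousAt_const _ (Or.inl hε.ne')
    exact continuousAt_const.sub (continuousAt_const.div (Real.continuousAt_log hR0) hlog)
  refine ge_of_tendsto ht ?_
  filter_upwards [Ioo_mem_nhdsLT (max_lt hR h2)] with r hr
  exact norm_le_rpow_of_norm_lt ((le_max_left _ _).trans_lt hr.1) hr.2 hF hF1 hFε h1
    ((le_max_right _ _).trans hr.1.le)

/-! ### The extremal Chebyshev series. -/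

theorem rpow_one_sub_ellipseExponent {R : ℝ} {z : ℂ} (hR : 1 < R) (hw : 1 < ‖joukowskiInv z‖) :
    R ^ (1 - ellipseExponent R z) = ‖joukowskiInv z‖ := by
  have hlog : Real.log R ≠ 0 := (Real.log_pos hR).ne'
  rw [Real.rpow_def_of_pos (by linarith), ellipseExponent, sub_sub_cancel, mul_div_cancel₀ _ hlog,
    Real.exp_log (by linarith)]

theorem ellipseExponent_mem_Ioo {R : ℝ} {z : ℂ} (hw : 1 < ‖joukowskiInv z‖)
    (hwR : ‖joukowskiInv z‖ < R) : ellipseExponent R z ∈ Set.Ioo (0 : ℝ) 1 := by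
  have h1 : 0 < Real.log ‖joukowskiInv z‖ := Real.log_pos hw
  have h2 : Real.log ‖joukowskiInv z‖ < Real.log R := Real.log_lt_log (by linarith) hwR
  have h3 := div_pos h1 (h1.trans h2)
  have h4 := (div_lt_one (h1.trans h2)).mpr h2
  constructor <;> unfold ellipseExponent <;> linarith

theorem extremalTerm_denom_eq (R ε : ℝ) (n : ℕ) :
    (1 + (ε : ℂ) ^ 2 * (R : ℂ) ^ (2 * n)) = ((1 + ε ^ 2 * R ^ (2 * n) : ℝ) : ℂ) := by
  push_cast; rfl

theorem extremalTerm_denom_pos {R : ℝ} (hR : 0 < R) (ε : ℝ) (n : ℕ) :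
    0 < 1 + ε ^ 2 * R ^ (2 * n) := by positivity

theorem norm_extremalTerm_le {R x : ℝ} {z ω : ℂ} (hR : 0 < R) (hω : 1 ≤ ‖ω‖)
    (hx : ‖joukowskiInv z‖ * ‖ω‖ ≤ x) (ε : ℝ) (n : ℕ) :
    ‖extremalTerm R z ε n (joukowski ω)‖ ≤ x ^ n / (1 + ε ^ 2 * R ^ (2 * n)) := by
  have hd := extremalTerm_denom_pos hR ε n
  rw [extremalTerm, extremalTerm_denom_eq, norm_div, norm_mul, norm_pow, RCLike.norm_conj,
    Complex.norm_of_nonneg hd.le]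
  gcongr
  calc ‖joukowskiInv z‖ ^ n * ‖(Polynomial.Chebyshev.T ℂ (n : ℤ)).eval (joukowski ω)‖
      ≤ ‖joukowskiInv z‖ ^ n * ‖ω‖ ^ n := by
        gcongr; exact norm_chebyshev_T_eval_joukowski_le hω n
    _ = (‖joukowskiInv z‖ * ‖ω‖) ^ n := (mul_pow _ _ _).symm
    _ ≤ x ^ n := by gcongr

theorem norm_extremalFun_le {R s K ε : ℝ} {z ω : ℂ} (hR : 0 < R) (hε : 0 < ε)
    (hS : Summable fun n : ℕ => (R ^ s) ^ (n + 1) / (1 + ε ^ 2 * R ^ (2 * (n + 1))))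
    (hK : ∑' n : ℕ, (R ^ s) ^ (n + 1) / (1 + ε ^ 2 * R ^ (2 * (n + 1))) ≤ K * ε ^ (-s))
    (hω : 1 ≤ ‖ω‖) (hx : ‖joukowskiInv z‖ * ‖ω‖ ≤ R ^ s) :
    ‖extremalFun R z ε (joukowski ω)‖ ≤ K * ε ^ (2 - ellipseExponent R z - s) := by
  have hb : ‖∑' n : ℕ, extremalTerm R z ε (n + 1) (joukowski ω)‖ ≤ K * ε ^ (-s) :=
    (tsum_of_norm_bounded hS.hasSum fun n => norm_extremalTerm_le hR hω hx ε (n + 1)).trans hK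
  rw [extremalFun, norm_mul, Complex.norm_of_nonneg (by positivity)]
  calc ε ^ (2 - ellipseExponent R z) * ‖∑' n : ℕ, extremalTerm R z ε (n + 1) (joukowski ω)‖
      ≤ ε ^ (2 - ellipseExponent R z) * (K * ε ^ (-s)) := by gcongr
    _ = K * ε ^ (2 - ellipseExponent R z - s) := by
        rw [sub_eq_add_neg (2 - ellipseExponent R z) s, Real.rpow_add hε]; ring

theorem differentiableOn_extremalFun {R x ε : ℝ} {z : ℂ} (hR : 1 < R)
    (hx : ‖joukowskiInv z‖ * R ≤ x)
    (hS : Summable fun n : ℕ => x ^ (n + 1) / (1 + ε ^ 2 * R ^ (2 * (n + 1)))) :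
    DifferentiableOn ℂ (extremalFun R z ε) (bernsteinEllipse R) := by
  unfold extremalFun
  apply DifferentiableOn.const_mul
  refine Complex.differentiableOn_tsum_of_summable_norm hS (fun n => ?_) (isOpen_bernsteinEllipse R) ?_
  · unfold extremalTerm
    exact (((Polynomial.differentiable _).const_mul _).div_const _).differentiableOn
  · intro n ζ hζ
    obtain ⟨ω, h1, h2, rfl⟩ := exists_joukowski_eq_of_mem_bernsteinEllipse hR hζ
    exact norm_extremalTerm_le (by linarith) h1
      ((mul_le_mul_of_nonneg_left h2.le (norm_nonneg _)).trans hx) ε (n + 1)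

/-- The numerator at `z` is `(|w| ^ (2n) + (conj w / w) ^ n) / 2`, whose second summand is
unimodular. -/
theorem le_re_extremalTerm {R : ℝ} {z : ℂ} (hR : 0 < R) (hz : joukowski (joukowskiInv z) = z)
    (hw : 1 < ‖joukowskiInv z‖) (ε : ℝ) (n : ℕ) :
    (‖joukowskiInv z‖ ^ (2 * n) - 1) / 2 / (1 + ε ^ 2 * R ^ (2 * n)) ≤
      (extremalTerm R z ε n z).re := by
  set w := joukowskiInv z with hwdef
  have hw0 : w ≠ 0 := norm_pos_iff.mp (by linarith)
  have hd := extremalTerm_denom_pos hR ε n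
  have hT := chebyshev_T_eval_joukowski hw0 n
  rw [hz] at hT
  rw [extremalTerm, extremalTerm_denom_eq, Complex.div_ofReal_re, hT, ← hwdef]
  gcongr
  have h1 : conj w ^ n * ((w ^ n + w⁻¹ ^ n) / 2) =
      (((‖w‖ ^ (2 * n) : ℝ) : ℂ) + (conj w * w⁻¹) ^ n) / ((2 : ℝ) : ℂ) := by
    have : ((‖w‖ ^ (2 * n) : ℝ) : ℂ) = conj w ^ n * w ^ n := by
      rw [← mul_pow, mul_comm (conj w), Complex.mul_conj, Complex.normSq_eq_norm_sq, pow_mul]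
      push_cast; rfl
    rw [this, mul_pow]; push_cast; ring
  have h2 : ‖(conj w * w⁻¹) ^ n‖ = 1 := by
    rw [norm_pow, norm_mul, RCLike.norm_conj, norm_inv, mul_inv_cancel₀ (by linarith), one_pow]
  have h3 := (abs_le.mp ((Complex.abs_re_le_norm ((conj w * w⁻¹) ^ n)).trans h2.le)).1
  rw [h1, Complex.div_ofReal_re, Complex.add_re, Complex.ofReal_re]
  linarith

theorem le_norm_extremalFun {R ε : ℝ} {z : ℂ} (hR : 1 < R)
    (hz : joukowski (joukowskiInv z) = z) (hw : 1 < ‖joukowskiInv z‖)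
    (hwR : ‖joukowskiInv z‖ < R) (hε : 0 < ε) (hε1 : ε ≤ 1)
    (hS : Summable fun n : ℕ => extremalTerm R z ε (n + 1) z) :
    (1 - (‖joukowskiInv z‖ ^ 2)⁻¹) / 2 / (1 + R ^ 2) * ε ^ ellipseExponent R z ≤
      ‖extremalFun R z ε z‖ := by
  have hR0 : 0 < R := by linarith
  obtain ⟨hα0, hα1⟩ := ellipseExponent_mem_Ioo hw hwR
  have hρ := rpow_one_sub_ellipseExponent hR hw
  set w := joukowskiInv z with hwdef
  set α := ellipseExponent R z with hα
  have hw0 : 0 < ‖w‖ := by linarith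
  -- Since `ε ≤ 1`, the peak index is a natural number; the term kept is `n = N + 1`.
  obtain ⟨N, hN1, hN2⟩ := exists_nat_pow_near ((one_le_inv₀ hε).mpr hε1) hR
  have hnonneg : ∀ n : ℕ, 0 ≤ (extremalTerm R z ε (n + 1) z).re := fun n =>
    le_trans (div_nonneg (div_nonneg (sub_nonneg.mpr (one_le_pow₀ hw.le)) zero_le_two)
      (extremalTerm_denom_pos hR0 ε (n + 1)).le) (le_re_extremalTerm hR0 hz hw ε (n + 1))
  have hre := Complex.hasSum_re hS.hasSum
  have hle : (extremalTerm R z ε (N + 1) z).re ≤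
      ‖∑' n : ℕ, extremalTerm R z ε (n + 1) z‖ :=
    (le_hasSum hre N fun n _ => hnonneg n).trans (Complex.re_le_norm _)
  have hpow : ε ^ (-(2 * (1 - α))) ≤ ‖w‖ ^ (2 * (N + 1)) := by
    calc ε ^ (-(2 * (1 - α))) = (ε⁻¹) ^ (2 * (1 - α)) := by
          rw [Real.rpow_neg hε.le, Real.inv_rpow hε.le]
      _ ≤ (R ^ (N + 1)) ^ (2 * (1 - α)) :=
          Real.rpow_le_rpow (by positivity) hN2.le (by linarith)
      _ = ‖w‖ ^ (2 * (N + 1)) := by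
          rw [← hρ, ← Real.rpow_natCast, ← Real.rpow_natCast, ← Real.rpow_mul hR0.le,
            ← Real.rpow_mul hR0.le]
          congr 1; push_cast; ring
  -- The factor `1 - |w|⁻²` absorbs the `-1`, because `|w| ^ (2N) ≥ 1`.
  have hnum : (1 - (‖w‖ ^ 2)⁻¹) * ε ^ (-(2 * (1 - α))) ≤ ‖w‖ ^ (2 * (N + 1)) - 1 := by
    have h1 : 0 ≤ 1 - (‖w‖ ^ 2)⁻¹ :=
      sub_nonneg.mpr (inv_le_one_of_one_le₀ (one_le_pow₀ hw.le))
    have h2 : (1 - (‖w‖ ^ 2)⁻¹) * ‖w‖ ^ (2 * (N + 1)) = ‖w‖ ^ (2 * (N + 1)) - ‖w‖ ^ (2 * N) := by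
      rw [mul_add, pow_add, mul_one]; field_simp
    have h3 : 1 ≤ ‖w‖ ^ (2 * N) := one_le_pow₀ hw.le
    have h4 := mul_le_mul_of_nonneg_left hpow h1
    linarith
  have hden : 1 + ε ^ 2 * R ^ (2 * (N + 1)) ≤ 1 + R ^ 2 := by
    have h1 : ε * R ^ N ≤ 1 := by
      calc ε * R ^ N ≤ ε * ε⁻¹ := by gcongr
        _ = 1 := mul_inv_cancel₀ hε.ne'
    have h2 : ε ^ 2 * R ^ (2 * (N + 1)) = (ε * R ^ N) ^ 2 * R ^ 2 := by ring
    have h3 : (ε * R ^ N) ^ 2 ≤ 1 := pow_le_one₀ (by positivity) h1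
    rw [h2]
    nlinarith [sq_nonneg R]
  have hterm : (1 - (‖w‖ ^ 2)⁻¹) * ε ^ (-(2 * (1 - α))) / 2 / (1 + R ^ 2) ≤
      (extremalTerm R z ε (N + 1) z).re := by
    refine le_trans ?_ (le_re_extremalTerm hR0 hz hw ε (N + 1))
    have : 0 ≤ ‖w‖ ^ (2 * (N + 1)) - 1 := sub_nonneg.mpr (one_le_pow₀ hw.le)
    gcongr
  rw [extremalFun, norm_mul, Complex.norm_of_nonneg (by positivity)]
  calc (1 - (‖w‖ ^ 2)⁻¹) / 2 / (1 + R ^ 2) * ε ^ α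
      = ε ^ (2 - α) * ((1 - (‖w‖ ^ 2)⁻¹) * ε ^ (-(2 * (1 - α))) / 2 / (1 + R ^ 2)) := by
        rw [show α = (2 - α) + (-(2 * (1 - α))) by ring, Real.rpow_add hε,
          show 2 - (2 - α + -(2 * (1 - α))) = 2 - α by ring,
          show -(2 * (1 - (2 - α + -(2 * (1 - α))))) = -(2 * (1 - α)) by ring]
        ring
    _ ≤ _ := by gcongr; exact hterm.trans hle

theorem exists_extremalFun_bounds {R : ℝ} {z : ℂ} (hR : 1 < R)
    (hz : joukowski (joukowskiInv z) = z) (hw : 1 < ‖joukowskiInv z‖)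
    (hwR : ‖joukowskiInv z‖ < R) :
    ∃ c C : ℝ, 0 < c ∧ 0 < C ∧ ∀ ε : ℝ, 0 < ε →
      (∀ ζ ∈ bernsteinEllipse R, Summable fun n : ℕ => extremalTerm R z ε (n + 1) ζ) ∧
      MemHInf (bernsteinEllipse R) (extremalFun R z ε) ∧
      hInfNorm (bernsteinEllipse R) (extremalFun R z ε) ≤ ENNReal.ofReal C ∧
      lInfNormInterval (extremalFun R z ε) ≤ ENNReal.ofReal (C * ε) ∧
      ‖extremalFun R z ε z‖ ≤ C * ε ^ ellipseExponent R z ∧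
      (ε ≤ 1 → c * ε ^ ellipseExponent R z ≤ ‖extremalFun R z ε z‖) := by
  have hR0 : 0 < R := by linarith
  obtain ⟨hα0, hα1⟩ := ellipseExponent_mem_Ioo hw hwR
  have hρ := rpow_one_sub_ellipseExponent hR hw
  set α := ellipseExponent R z with hα
  have hρR : R ^ (2 - α) = ‖joukowskiInv z‖ * R := by
    rw [← hρ, ← Real.rpow_add_one hR0.ne']; congr 1; ring
  have hρρ : R ^ (2 * (1 - α)) = ‖joukowskiInv z‖ * ‖joukowskiInv z‖ := by
    rw [← hρ, ← Real.rpow_add hR0]; congr 1; ring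
  -- `R ^ s` dominates `|w| |ω|`: it is `|w| R` on the ellipse, `|w|` on the interval and `|w|²` at
  -- `z`. The resulting powers `ε ^ (2 - α - s)` are `1`, `ε` and `ε ^ α`.
  obtain ⟨K₁, hK₁, H₁⟩ := exists_tsum_pow_div_le hR (s := 2 - α) (by linarith) (by linarith)
  obtain ⟨K₂, hK₂, H₂⟩ := exists_tsum_pow_div_le hR (s := 1 - α) (by linarith) (by linarith)
  obtain ⟨K₃, hK₃, H₃⟩ := exists_tsum_pow_div_le hR (s := 2 * (1 - α)) (by linarith) (by linarith)
  have hc : 0 < (1 - (‖joukowskiInv z‖ ^ 2)⁻¹) / 2 / (1 + R ^ 2) := by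
    have : 0 < 1 - (‖joukowskiInv z‖ ^ 2)⁻¹ :=
      sub_pos.mpr (inv_lt_one_of_one_lt₀ (one_lt_pow₀ hw two_ne_zero))
    positivity
  refine ⟨_, K₁ + K₂ + K₃, hc, by positivity, fun ε hε => ?_⟩
  obtain ⟨S₁, B₁⟩ := H₁ ε hε
  obtain ⟨S₂, B₂⟩ := H₂ ε hε
  obtain ⟨S₃, B₃⟩ := H₃ ε hε
  have hsum : ∀ ζ ∈ bernsteinEllipse R,
      Summable fun n : ℕ => extremalTerm R z ε (n + 1) ζ := by
    intro ζ hζ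
    obtain ⟨ω, h1, h2, rfl⟩ := exists_joukowski_eq_of_mem_bernsteinEllipse hR hζ
    refine Summable.of_norm_bounded S₁ fun n => norm_extremalTerm_le hR0 h1 ?_ ε (n + 1)
    rw [hρR]; gcongr
  have hbound : hInfNorm (bernsteinEllipse R) (extremalFun R z ε) ≤
      ENNReal.ofReal (K₁ + K₂ + K₃) := by
    refine hInfNorm_le_ofReal fun ζ hζ => ?_
    obtain ⟨ω, h1, h2, rfl⟩ := exists_joukowski_eq_of_mem_bernsteinEllipse hR hζ
    have := norm_extremalFun_le (z := z) hR0 hε S₁ B₁ h1 (by rw [hρR]; gcongr)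
    rw [← hα, sub_self, Real.rpow_zero, mul_one] at this
    linarith
  refine ⟨hsum, ⟨differentiableOn_extremalFun hR hρR.ge S₁, hbound.trans_lt ENNReal.ofReal_lt_top⟩,
    hbound, ?_, ?_, fun hε1 => ?_⟩
  · refine lInfNormInterval_le_ofReal fun x hx => ?_
    obtain ⟨ω, h1, h2⟩ := exists_joukowski_eq_ofReal hx
    have := norm_extremalFun_le (z := z) hR0 hε S₂ B₂ h1.ge (by rw [hρ, h1, mul_one])
    rw [← hα, show 2 - α - (1 - α) = 1 by ring, Real.rpow_one, h2] at this
    refine this.trans ?_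
    gcongr
    linarith
  · have := norm_extremalFun_le (z := z) hR0 hε S₃ B₃ hw.le hρρ.ge
    rw [← hα, show 2 - α - 2 * (1 - α) = α by ring, hz] at this
    refine this.trans ?_
    gcongr
    linarith
  · refine le_norm_extremalFun hR hz hw hwR hε hε1 (hsum z ?_)
    rw [← hz, joukowski_mem_bernsteinEllipse_iff hR hw.le]
    exact hwR

/-! ### Assembly of the three claims. -/

theorem mainTheorem3 (R : ℝ) (hR : 1 < R) (z : ℂ)
    (hz : z ∈ bernsteinEllipse R \ realSegment) :
    -- the branch of the inverse Joukowski map and the exponent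
    (joukowski (joukowskiInv z) = z ∧ 1 < ‖joukowskiInv z‖ ∧ ‖joukowskiInv z‖ < R) ∧
    ellipseExponent R z ∈ Set.Ioo (0 : ℝ) 1 ∧
    -- the upper bound
    (∃ C : ℝ, 0 < C ∧ ∀ ε : ℝ, 0 < ε → ∀ F : ℂ → ℂ,
      MemHInf (bernsteinEllipse R) F → hInfNorm (bernsteinEllipse R) F ≤ 1 →
      lInfNormInterval F ≤ ENNReal.ofReal ε →
        ‖F z‖ ≤ C * ε ^ ellipseExponent R z) ∧
    -- asymptotic optimality of the bound
    (∃ c : ℝ, 0 < c ∧ ∀ ε : ℝ, 0 < ε → ε ≤ 1 → ∃ F : ℂ → ℂ,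
      MemHInf (bernsteinEllipse R) F ∧ hInfNorm (bernsteinEllipse R) F ≤ 1 ∧
      lInfNormInterval F ≤ ENNReal.ofReal ε ∧
        c * ε ^ ellipseExponent R z ≤ ‖F z‖) ∧
    -- the explicit Chebyshev series attains it, up to constants independent of `ε`
    (∃ c C : ℝ, 0 < c ∧ 0 < C ∧ ∀ ε : ℝ, 0 < ε →
      (∀ ζ ∈ bernsteinEllipse R, Summable fun n : ℕ => extremalTerm R z ε (n + 1) ζ) ∧
      MemHInf (bernsteinEllipse R) (extremalFun R z ε) ∧
      hInfNorm (bernsteinEllipse R) (extremalFun R z ε) ≤ ENNReal.ofReal C ∧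
      lInfNormInterval (extremalFun R z ε) ≤ ENNReal.ofReal (C * ε) ∧
      ‖extremalFun R z ε z‖ ≤ C * ε ^ ellipseExponent R z ∧
      (ε ≤ 1 → c * ε ^ ellipseExponent R z ≤ ‖extremalFun R z ε z‖)) := by
  obtain ⟨hJ, hw⟩ := joukowskiInv_spec hz.2
  have hwR : ‖joukowskiInv z‖ < R :=
    (joukowski_mem_bernsteinEllipse_iff hR hw.le).mp (by rw [hJ]; exact hz.1)
  have hext := exists_extremalFun_bounds hR hJ hw hwR
  refine ⟨⟨hJ, hw, hwR⟩, ellipseExponent_mem_Ioo hw hwR, ?_, ?_, hext⟩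
  · refine ⟨1, one_pos, fun ε hε F hF hF1 hFε => ?_⟩
    have hcont : ContinuousOn (fun x : ℝ => F x) (Set.Icc (-1) 1) :=
      hF.1.continuousOn.comp Complex.continuous_ofReal.continuousOn
        fun x hx => ofReal_mem_bernsteinEllipse hR hx
    have := norm_le_rpow_ellipseExponent hR hε hF.1
      (fun ζ hζ => norm_le_of_hInfNorm_le zero_le_one (by simpa using hF1) hζ)
      (fun x hx => norm_le_of_lInfNormInterval_le hε.le hcont hFε hx) hw.le hwR
    rwa [hJ, ← ellipseExponent, ← one_mul (ε ^ _)] at this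
  · obtain ⟨c, C, hc, hC, h⟩ := hext
    -- The witness is `C⁻¹ M`: one constant `C` normalises both the sup norm and the interval norm.
    refine ⟨c / C, div_pos hc hC, fun ε hε hε1 => ?_⟩
    obtain ⟨-, hmem, hH, hL, -, hlow⟩ := h ε hε
    have hnorm : ∀ ζ, ‖(C : ℂ)⁻¹ * extremalFun R z ε ζ‖ = C⁻¹ * ‖extremalFun R z ε ζ‖ := fun ζ => by
      rw [norm_mul, norm_inv, Complex.norm_of_nonneg hC.le]
    have hcont : ContinuousOn (fun x : ℝ => extremalFun R z ε x) (Set.Icc (-1) 1) :=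
      hmem.1.continuousOn.comp Complex.continuous_ofReal.continuousOn
        fun x hx => ofReal_mem_bernsteinEllipse hR hx
    have hle : hInfNorm (bernsteinEllipse R) (fun ζ => (C : ℂ)⁻¹ * extremalFun R z ε ζ) ≤ 1 := by
      rw [← ENNReal.ofReal_one]
      refine hInfNorm_le_ofReal fun ζ hζ => ?_
      rw [hnorm, inv_mul_le_iff₀ hC, mul_one]
      exact norm_le_of_hInfNorm_le hC.le hH hζ
    refine ⟨fun ζ => (C : ℂ)⁻¹ * extremalFun R z ε ζ,
      ⟨hmem.1.const_mul _, hle.trans_lt ENNReal.one_lt_top⟩, hle, ?_, ?_⟩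
    · refine lInfNormInterval_le_ofReal fun x hx => ?_
      rw [hnorm, inv_mul_le_iff₀ hC]
      exact norm_le_of_lInfNormInterval_le (by positivity) hcont hL hx
    · rw [hnorm, div_mul_eq_mul_div, div_eq_inv_mul]
      gcongr
      exact hlow hε1
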